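/- Let $d\ge 2$ and $k\ge 1$. Let $P$ be the set of all pairs $(i,j)$, $1\le i<j\le k+1$, if $k\le d$; if $k>d$, let $P$ be a fixed maximal set of such pairs that is independent in $\mathbb R^d$ (i.e. for some $x^1,\dots,x^{k+1}\in\mathbb R^d$ the linear functionals $(v^1,\dots,v^{k+1})\mapsto (x^i-x^j)\cdot(v^i-v^j)$, $(i,j)\in P$, are linearly independent). Put $\vec v(x^1,\dots,x^{k+1})=(|x^i-x^j|)_{(i,j)\in P}\in\mathbb R^P$ and, for $E\subset\mathbb R^d$ and $r>0$, $$\Delta_k(E)=\{\vec v(x^1,\dots,x^{k+1}):x^i\in E\},\qquad \Delta_k^r(E)=\{\vec t\in\Delta_k(E): r\vec t\in\Delta_k(E)\}.$$ A Frostman measure on $E$ with exponent $\alpha$ is a nonzero finite Borel measure $\mu$ on $\mathbb R^d$ with $\mu(\mathbb R^d\setminus E)=0$ for which there is a constant $C$ such that $\mu(B(x,\rho))\le C\rho^{\alpha}$ for all $x\in\mathbb R^d$, $\rho>0$. For such $\mu$ let $\nu_k$ be the image of $\mu\times\dots\times\mu$ ($k+1$ factors) under $\vec v$. Let $s_{k,d}$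 be the infimum of all $s\ge 0$ such that for every compact $E\subset\mathbb R^d$ with $\dim_{\mathcal H}(E)>s$ and every Frostman measure $\mu$ on $E$ with some exponent greater than $s$, the measure $\nu_k$ is absolutely continuous with a density (again written $\nu_k$) satisfying $\int_{\Delta_k(E)}\nu_k(\vec t)^2\,d\vec t<\infty$. Theorem. Let $E\subset\mathbb R^d$ be compact with $\dim_{\mathcal H}(E)>s_{k,d}$, let $\mu$ be a Frostman measure on $E$ with an exponent $\alpha>s_{k,d}$, and let $\nu_k$ be the measure induced by $\mu$. (a) There are distinct $r_1,r_2\in(0,\infty)\setminus\{1\}$ with $\nu_k(\Delta_k^{r_1}(E)\cap\Delta_k^{r_2}(E))>0$; moreover, there are $(k+1)$-tuples $(x^i),(y^i),(z^i)$ of points of $E$ with $|x^i-x^j|>0$, $|y^i-y^j|=r_1|x^i-x^j|$ and $|z^i-z^j|=r_2|x^i-x^j|$ for all $(i,j)\in P$. (b) For every partition of $(0,\infty)$ into nonempty countable sets there are $r_1,r_2\ne 1$ in two different parts of the partition with $\nu_k(\Delta_k^{r_1}(E)\cap\Delta_k^{r_2}(E))>0$. (c) In particular, there are $r_1,r_2\in(0,\infty)\setminus\{1\}$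 with $r_2/r_1$ irrational, and even transcendental, such that $\nu_k(\Delta_k^{r_1}(E)\cap\Delta_k^{r_2}(E))>0$. -/

import Mathlib

open MeasureTheory Set
open scoped ENNReal NNReal

noncomputable section

namespace PointConfig

/-- All edges `(i, j)`, `i < j`, of the complete graph on `k + 1` vertices. -/
def allEdges (k : ℕ) : Finset (Fin (k + 1) × Fin (k + 1)) :=
  Finset.univ.filter fun e => e.1 < e.2

/-- The row of the rigidity matrix of the framework `x` that belongs to the edge `e = (i, j)`:
the linear functional `v ↦ ⟪x i - x j, v i - v j⟫`, which is one half of the derivative at `x` of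
`|x i - x j| ^ 2`. -/
def rigidityRow {d k : ℕ} (x : Fin (k + 1) → EuclideanSpace ℝ (Fin d))
    (e : Fin (k + 1) × Fin (k + 1)) :
    (Fin (k + 1) → EuclideanSpace ℝ (Fin d)) →ₗ[ℝ] ℝ :=
  (innerₗ (EuclideanSpace ℝ (Fin d)) (x e.1 - x e.2)) ∘ₗ
    (LinearMap.proj (R := ℝ) (φ := fun _ : Fin (k + 1) => EuclideanSpace ℝ (Fin d)) e.1 -
      LinearMap.proj (R := ℝ) (φ := fun _ : Fin (k + 1) => EuclideanSpace ℝ (Fin d)) e.2)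

/-- A set of edges is (generically) independent in `ℝ^d` if its rows of the rigidity matrix are
linearly independent for some, equivalently for almost every, choice of the `k + 1` points. -/
def IndependentEdges (d : ℕ) {k : ℕ} (P : Finset (Fin (k + 1) × Fin (k + 1))) : Prop :=
  ∃ x : Fin (k + 1) → EuclideanSpace ℝ (Fin d),
    LinearIndependent ℝ fun e : P => rigidityRow x e.1

/-- The sets of edges whose lengths are recorded: all `k (k + 1) / 2` edges if `k ≤ d`, and a
maximally independent set of edges (it has `d (k + 1) - d (d + 1) / 2` elements) if `k > d`. -/
def IsEdgeSystem (d k : ℕ) (P : Finset (Fin (k + 1) × Fin (k + 1))) : Prop :=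
  (k ≤ d ∧ P = allEdges k) ∨
    (d < k ∧ Maximal (fun Q => Q ⊆ allEdges k ∧ IndependentEdges d Q) P)

variable {d k : ℕ}

/-- The vector of the distances `|x i - x j|`, `(i, j) ∈ P`. -/
def distVec (P : Finset (Fin (k + 1) × Fin (k + 1)))
    (x : Fin (k + 1) → EuclideanSpace ℝ (Fin d)) : P → ℝ :=
  fun e => dist (x e.1.1) (x e.1.2)

/-- The configuration set `Δ_k(E)`. -/
def configSet (P : Finset (Fin (k + 1) × Fin (k + 1))) (E : Set (EuclideanSpace ℝ (Fin d))) :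
    Set (P → ℝ) :=
  {t | ∃ x : Fin (k + 1) → EuclideanSpace ℝ (Fin d), (∀ i, x i ∈ E) ∧ distVec P x = t}

/-- The set `Δ_k^r(E)` of all `t ∈ Δ_k(E)` with `r t ∈ Δ_k(E)`. -/
def simSet (P : Finset (Fin (k + 1) × Fin (k + 1))) (E : Set (EuclideanSpace ℝ (Fin d)))
    (r : ℝ) : Set (P → ℝ) :=
  {t | t ∈ configSet P E ∧ r • t ∈ configSet P E}

/-- The measure `ν_k` induced by `μ`: the image of `μ × ⋯ × μ` (`k + 1` factors) under the
distance vector, so that `∫ f dν_k = ∫ ⋯ ∫ f (distVec P x) dμ(x 0) ⋯ dμ(x k)`. -/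
def configMeasure (P : Finset (Fin (k + 1) × Fin (k + 1)))
    (μ : Measure (EuclideanSpace ℝ (Fin d))) : Measure (P → ℝ) :=
  (Measure.pi fun _ : Fin (k + 1) => μ).map (distVec P)

/-- `μ` is a Frostman measure on `E` with exponent `α`: a nonzero finite Borel measure carried by
`E` such that `μ (B(x, r)) ≤ C r ^ α` for all balls. -/
structure IsFrostman (α : ℝ≥0) (E : Set (EuclideanSpace ℝ (Fin d)))
    (μ : Measure (EuclideanSpace ℝ (Fin d))) : Prop where
  ne_zero : μ ≠ 0
  finite : μ univ < ∞
  carried : μ Eᶜ = 0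
  ball_le : ∃ C : ℝ≥0, ∀ (x : EuclideanSpace ℝ (Fin d)) (r : ℝ), 0 < r →
    μ (Metric.closedBall x r) ≤ C * ENNReal.ofReal (r ^ (α : ℝ))

/-- `ν_k` is absolutely continuous, with a density that is square integrable over `Δ_k(E)`. -/
def HasL2Density (P : Finset (Fin (k + 1) × Fin (k + 1))) (E : Set (EuclideanSpace ℝ (Fin d)))
    (μ : Measure (EuclideanSpace ℝ (Fin d))) : Prop :=
  ∃ f : (P → ℝ) → ℝ≥0∞, Measurable f ∧ configMeasure P μ = volume.withDensity f ∧
    ∫⁻ t in configSet P E, f t ^ 2 < ∞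

/-- The `L^2`-threshold `s_{k,d}`: the infimum of all `s` such that for every compact `E ⊆ ℝ^d` of
Hausdorff dimension greater than `s`, the measure `ν_k` induced by a Frostman measure on `E` (of an
exponent greater than `s`) has a density in `L^2`. -/
def l2Threshold (d : ℕ) {k : ℕ} (P : Finset (Fin (k + 1) × Fin (k + 1))) : ℝ≥0∞ :=
  sInf {s : ℝ≥0∞ | ∀ E : Set (EuclideanSpace ℝ (Fin d)), IsCompact E → s < dimH E →
    ∀ (α : ℝ≥0) (μ : Measure (EuclideanSpace ℝ (Fin d))), s < α → IsFrostman α E μ →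
      HasL2Density P E μ}

end PointConfig

end

open MeasureTheory Set Filter Topology
open scoped ENNReal NNReal Pointwise

namespace PointConfig

section Dilation

variable {V : Type*} [NormedAddCommGroup V] [NormedSpace ℝ V] [MeasurableSpace V] [BorelSpace V]
  [FiniteDimensional ℝ V]

/-- A dilation by a factor close to `1` moves only a small part of a compact set out of it. -/
lemma eventually_measure_inter_smul_notMem_le (m : Measure V) [m.IsAddHaarMeasure] {K : Set V}
    (hK : IsCompact K) {ε : ℝ≥0∞} (hε : ε ≠ 0) :
    ∀ᶠ r : ℝ in 𝓝 1, m {t ∈ K | r • t ∉ K} ≤ ε := by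
  have hε2 : ε / 2 ≠ 0 := by simpa using hε
  obtain ⟨U, hKU, hU, hmU⟩ := hK.exists_isOpen_lt_add (μ := m) hε2
  have hmaps : ∀ᶠ r : ℝ in 𝓝 1, ∀ t ∈ K, r • t ∈ U := by
    refine hK.eventually_forall_of_forall_eventually fun t ht => ?_
    have hc : Tendsto (fun z : ℝ × V => z.1 • z.2) (𝓝 (1, t)) (𝓝 ((1 : ℝ) • t)) :=
      (continuous_fst.smul continuous_snd).tendsto (1, t)
    exact hc.eventually (hU.mem_nhds (by simpa using hKU ht))
  have hpow : ∀ᶠ r : ℝ in 𝓝 1, (1 / 2 : ℝ) < |r ^ Module.finrank ℝ V| := by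
    have hc : Tendsto (fun r : ℝ => |r ^ Module.finrank ℝ V|) (𝓝 1)
        (𝓝 |(1 : ℝ) ^ Module.finrank ℝ V|) :=
      (continuous_abs.comp (continuous_pow _)).tendsto 1
    exact hc.eventually (lt_mem_nhds (by norm_num))
  filter_upwards [hmaps, hpow] with r hr hr2
  set N := {t ∈ K | r • t ∉ K}
  have hsub : r • N ⊆ U \ K := by
    rintro _ ⟨t, ht, rfl⟩
    exact ⟨hr t ht.1, ht.2⟩
  have hdiff : m (U \ K) ≤ ε / 2 := by
    rw [measure_sdiff hKU hK.measurableSet.nullMeasurableSet hK.measure_lt_top.ne]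
    exact tsub_le_iff_left.2 hmU.le
  have h1 : ENNReal.ofReal (1 / 2) * m N ≤ ε / 2 :=
    calc ENNReal.ofReal (1 / 2) * m N
        ≤ ENNReal.ofReal |r ^ Module.finrank ℝ V| * m N := by gcongr
      _ = m (r • N) := (Measure.addHaar_smul m r N).symm
      _ ≤ ε / 2 := (measure_mono hsub).trans hdiff
  have h2 : ENNReal.ofReal (1 / 2) = 2⁻¹ := by
    rw [one_div, ENNReal.ofReal_inv_of_pos two_pos]; simp
  rw [h2, mul_comm, ← div_eq_mul_inv] at h1
  calc m N = m N / 2 * 2 := (ENNReal.div_mul_cancel two_ne_zero ENNReal.ofNat_ne_top).symm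
    _ ≤ ε / 2 * 2 := by gcongr
    _ = ε := ENNReal.div_mul_cancel two_ne_zero ENNReal.ofNat_ne_top

/-- A set of positive measure meets its dilates by any two factors close to `1` in a set of
positive measure. -/
lemma exists_nhds_one_measure_inter_dilates_pos (m : Measure V) [m.IsAddHaarMeasure] {A : Set V}
    (hA : MeasurableSet A) (hpos : 0 < m A) :
    ∃ U ∈ 𝓝 (1 : ℝ), ∀ r₁ ∈ U, ∀ r₂ ∈ U, 0 < m {t ∈ A | r₁ • t ∈ A ∧ r₂ • t ∈ A} := by
  obtain ⟨K, hKA, hK, hKpos⟩ := hA.exists_lt_isCompact hpos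
  have hKtop : m K ≠ ∞ := hK.measure_lt_top.ne
  refine ⟨_, eventually_measure_inter_smul_notMem_le m hK (ε := m K / 4)
    (by simpa using hKpos.ne'), fun r₁ h₁ r₂ h₂ => ?_⟩
  rw [mem_ofPred_eq] at h₁ h₂
  by_contra hzero
  have hzero := le_of_not_gt hzero
  have hcover : K ⊆ {t ∈ A | r₁ • t ∈ A ∧ r₂ • t ∈ A} ∪
      ({t ∈ K | r₁ • t ∉ K} ∪ {t ∈ K | r₂ • t ∉ K}) := by
    intro t ht
    by_cases h1 : r₁ • t ∈ K
    · by_cases h2 : r₂ • t ∈ K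
      · exact Or.inl ⟨hKA ht, hKA h1, hKA h2⟩
      · exact Or.inr (Or.inr ⟨ht, h2⟩)
    · exact Or.inr (Or.inl ⟨ht, h1⟩)
  have hle : m K ≤ 0 + (m K / 4 + m K / 4) :=
    (measure_mono hcover).trans <| (measure_union_le _ _).trans <|
      add_le_add hzero <| (measure_union_le _ _).trans (add_le_add h₁ h₂)
  have hreal : (m K).toReal ≤ (m K).toReal / 4 + (m K).toReal / 4 := by
    have hq : m K / 4 ≠ ∞ := ENNReal.div_ne_top hKtop (by norm_num)
    have := ENNReal.toReal_mono (by simp [hq]) hle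
    rwa [zero_add, ENNReal.toReal_add hq hq, ENNReal.toReal_div, ENNReal.toReal_ofNat] at this
  have := ENNReal.toReal_pos hKpos.ne' hKtop
  linarith

end Dilation

variable {d k : ℕ} {P : Finset (Fin (k + 1) × Fin (k + 1))} {E : Set (EuclideanSpace ℝ (Fin d))}
  {μ : Measure (EuclideanSpace ℝ (Fin d))} {α : ℝ≥0}

lemma continuous_distVec (P : Finset (Fin (k + 1) × Fin (k + 1))) :
    Continuous (distVec (d := d) P) :=
  continuous_pi fun e => (continuous_apply e.1.1).dist (continuous_apply e.1.2)

lemma configSet_eq_image (P : Finset (Fin (k + 1) × Fin (k + 1)))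
    (E : Set (EuclideanSpace ℝ (Fin d))) :
    configSet P E = distVec P '' univ.pi fun _ => E := by
  ext t
  simp [configSet]

lemma isCompact_configSet (P : Finset (Fin (k + 1) × Fin (k + 1))) (hE : IsCompact E) :
    IsCompact (configSet P E) := by
  rw [configSet_eq_image]
  exact (isCompact_univ_pi fun _ => hE).image (continuous_distVec P)

lemma configMeasure_configSet_pos (P : Finset (Fin (k + 1) × Fin (k + 1))) (hE : IsCompact E)
    (hμ : IsFrostman α E μ) : 0 < configMeasure P μ (configSet P E) := by
  have : IsFiniteMeasure μ := ⟨hμ.finite⟩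
  have hμE : μ E ≠ 0 := by
    intro h0
    refine hμ.ne_zero (Measure.measure_univ_eq_zero.1 ?_)
    rw [← union_compl_self E]
    exact measure_union_null h0 hμ.carried
  rw [configMeasure, Measure.map_apply (continuous_distVec P).measurable
    (isCompact_configSet P hE).measurableSet]
  refine lt_of_lt_of_le ?_ (measure_mono (configSet_eq_image P E ▸ subset_preimage_image _ _))
  rw [Measure.pi_pi]
  simpa [pos_iff_ne_zero] using hμE

lemma hasL2Density_of_l2Threshold_lt (hE : IsCompact E) (hdim : l2Threshold d P < dimH E)
    (hα : l2Threshold d P < α) (hμ : IsFrostman α E μ) : HasL2Density P E μ := by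
  obtain ⟨s, hs, hlt⟩ := sInf_lt_iff.1 (lt_min hdim hα)
  exact hs E hE (hlt.trans_le (min_le_left _ _)) α μ (hlt.trans_le (min_le_right _ _)) hμ

lemma HasL2Density.absolutelyContinuous (h : HasL2Density P E μ) :
    configMeasure P μ ≪ volume := by
  obtain ⟨f, -, hν, -⟩ := h
  exact hν ▸ withDensity_absolutelyContinuous _ _

/-- All pairs of scaling factors close to `1` occur together, on a set of positive measure. -/
lemma HasL2Density.exists_nhds_one (h : HasL2Density P E μ) (hE : IsCompact E)
    (hμ : IsFrostman α E μ) :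
    ∃ U ∈ 𝓝 (1 : ℝ), ∀ r₁ ∈ U, ∀ r₂ ∈ U,
      0 < configMeasure P μ (simSet P E r₁ ∩ simSet P E r₂) := by
  obtain ⟨f, hf, hν, -⟩ := h
  have hpos := configMeasure_configSet_pos P hE hμ
  have hmeas := (isCompact_configSet P hE).measurableSet
  rw [hν, pos_iff_ne_zero, Ne, withDensity_apply_eq_zero hf] at hpos
  obtain ⟨U, hU, hUpos⟩ := exists_nhds_one_measure_inter_dilates_pos volume
    ((measurableSet_eq_fun hf measurable_const).compl.inter hmeas) (pos_iff_ne_zero.2 hpos)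
  refine ⟨U, hU, fun r₁ h₁ r₂ h₂ => ?_⟩
  rw [hν, pos_iff_ne_zero, Ne, withDensity_apply_eq_zero hf]
  refine ((hUpos r₁ h₁ r₂ h₂).trans_le (measure_mono ?_)).ne'
  rintro t ⟨⟨htf, ht⟩, ht₁, ht₂⟩
  exact ⟨htf, ⟨ht, ht₁.2⟩, ht, ht₂.2⟩

lemma ae_configMeasure_ne_zero (h : configMeasure P μ ≪ volume) :
    ∀ᵐ t ∂configMeasure P μ, ∀ e, t e ≠ 0 :=
  h.ae_le (ae_all_iff.2 fun e => by
    rw [ae_iff]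
    simpa [volume_pi, preimage] using
      Measure.pi_eval_preimage_null (fun _ : P => (volume : Measure ℝ)) (i := e)
        (measure_singleton (0 : ℝ)))

lemma exists_mem_notMem_of_countable {U C : Set ℝ} (hU : U ∈ 𝓝 (1 : ℝ)) (hC : C.Countable) :
    ∃ r ∈ U, 0 < r ∧ r ≠ 1 ∧ r ∉ C := by
  obtain ⟨r, hr, hrU⟩ := ((hC.insert 1).dense_compl ℝ).inter_nhds_nonempty
    (inter_mem hU (Ioi_mem_nhds (zero_lt_one' ℝ)))
  simp only [mem_compl_iff, mem_insert_iff, not_or] at hr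
  exact ⟨r, hrU.1, hrU.2, hr.1, hr.2⟩

end PointConfig

theorem theorem1p3 (d k : ℕ) (hd : 2 ≤ d) (hk : 1 ≤ k)
    (P : Finset (Fin (k + 1) × Fin (k + 1))) (hP : PointConfig.IsEdgeSystem d k P)
    (E : Set (EuclideanSpace ℝ (Fin d))) (hE : IsCompact E)
    (hdim : PointConfig.l2Threshold d P < dimH E)
    (α : ℝ≥0) (hα : PointConfig.l2Threshold d P < α)
    (μ : Measure (EuclideanSpace ℝ (Fin d))) (hμ : PointConfig.IsFrostman α E μ) :
    -- two distinct scaling factors, and an actual triple of similar configurations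
    (∃ r₁ r₂ : ℝ, 0 < r₁ ∧ 0 < r₂ ∧ r₁ ≠ r₂ ∧ r₁ ≠ 1 ∧ r₂ ≠ 1 ∧
      0 < PointConfig.configMeasure P μ
        (PointConfig.simSet P E r₁ ∩ PointConfig.simSet P E r₂) ∧
      ∃ x y z : Fin (k + 1) → EuclideanSpace ℝ (Fin d),
        (∀ i, x i ∈ E ∧ y i ∈ E ∧ z i ∈ E) ∧
        ∀ e ∈ P, 0 < dist (x e.1) (x e.2) ∧
          dist (y e.1) (y e.2) = r₁ * dist (x e.1) (x e.2) ∧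
          dist (z e.1) (z e.2) = r₂ * dist (x e.1) (x e.2)) ∧
    -- any partition of `(0, ∞)` into nonempty countable sets
    (∀ R : Set (Set ℝ), (∀ S ∈ R, S.Nonempty ∧ S.Countable) → R.PairwiseDisjoint id →
      ⋃₀ R = Ioi (0 : ℝ) →
      ∃ S₁ ∈ R, ∃ S₂ ∈ R, S₁ ≠ S₂ ∧ ∃ r₁ ∈ S₁, ∃ r₂ ∈ S₂, r₁ ≠ 1 ∧ r₂ ≠ 1 ∧
        0 < PointConfig.configMeasure P μ
          (PointConfig.simSet P E r₁ ∩ PointConfig.simSet P E r₂)) ∧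
    -- in particular, a ratio that is irrational and even transcendental
    (∃ r₁ r₂ : ℝ, 0 < r₁ ∧ 0 < r₂ ∧ r₁ ≠ 1 ∧ r₂ ≠ 1 ∧
      Irrational (r₂ / r₁) ∧ Transcendental ℚ (r₂ / r₁) ∧
      0 < PointConfig.configMeasure P μ
        (PointConfig.simSet P E r₁ ∩ PointConfig.simSet P E r₂)) := by
  have hL2 := PointConfig.hasL2Density_of_l2Threshold_lt hE hdim hα hμ
  obtain ⟨U, hU, hpos⟩ := hL2.exists_nhds_one hE hμ
  refine ⟨?_, ?_, ?_⟩
  · obtain ⟨r₁, h₁U, h₁pos, h₁, -⟩ :=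
      PointConfig.exists_mem_notMem_of_countable hU countable_empty
    obtain ⟨r₂, h₂U, h₂pos, h₂, h₁₂⟩ :=
      PointConfig.exists_mem_notMem_of_countable hU (countable_singleton r₁)
    have hν := hpos r₁ h₁U r₂ h₂U
    refine ⟨r₁, r₂, h₁pos, h₂pos, fun h => h₁₂ h.symm, h₁, h₂, hν, ?_⟩
    obtain ⟨t, ⟨⟨⟨x, hx, hxt⟩, y, hy, hyt⟩, -, z, hz, hzt⟩, ht⟩ :=
      ((frequently_ae_mem_iff.2 hν.ne').and_eventually
        (PointConfig.ae_configMeasure_ne_zero hL2.absolutelyContinuous)).exists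
    refine ⟨x, y, z, fun i => ⟨hx i, hy i, hz i⟩, fun e he => ?_⟩
    have hxe : dist (x e.1) (x e.2) = t ⟨e, he⟩ := congrFun hxt ⟨e, he⟩
    rw [hxe]
    exact ⟨lt_of_le_of_ne (hxe ▸ dist_nonneg) (ht ⟨e, he⟩).symm,
      congrFun hyt ⟨e, he⟩, congrFun hzt ⟨e, he⟩⟩
  · intro R hR _ hcover
    obtain ⟨r₁, h₁U, h₁pos, h₁, -⟩ :=
      PointConfig.exists_mem_notMem_of_countable hU countable_empty
    obtain ⟨S₁, hS₁, hr₁⟩ := hcover.symm ▸ mem_Ioi.2 h₁pos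
    obtain ⟨r₂, h₂U, h₂pos, h₂, h₁₂⟩ :=
      PointConfig.exists_mem_notMem_of_countable hU (hR S₁ hS₁).2
    obtain ⟨S₂, hS₂, hr₂⟩ := hcover.symm ▸ mem_Ioi.2 h₂pos
    exact ⟨S₁, hS₁, S₂, hS₂, fun h => h₁₂ (h ▸ hr₂), r₁, hr₁, r₂, hr₂, h₁, h₂,
      hpos r₁ h₁U r₂ h₂U⟩
  · obtain ⟨r₁, h₁U, h₁pos, h₁, -⟩ :=
      PointConfig.exists_mem_notMem_of_countable hU countable_empty
    obtain ⟨r₂, h₂U, h₂pos, h₂, h₁₂⟩ :=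
      PointConfig.exists_mem_notMem_of_countable hU
        ((Algebraic.countable ℚ ℝ).image (· * r₁))
    have htr : Transcendental ℚ (r₂ / r₁) := fun halg =>
      h₁₂ ⟨r₂ / r₁, halg, div_mul_cancel₀ r₂ h₁pos.ne'⟩
    exact ⟨r₁, r₂, h₁pos, h₂pos, h₁, h₂, htr.irrational, htr, hpos r₁ h₁U r₂ h₂U⟩
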